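/- **Theorem 1.** Let $N,K$ be natural numbers and let $\sigma:\mathbb R\to\mathbb R$ be a continuous function that is not a polynomial. Inputs are pairs $(\mathbf H,\mathbf y)\in\mathbb R^{N\times K}\times\mathbb R^N=\mathbb R^{N\times(K+1)}$. A *multilayer perceptron* (MLP) is a finite composition of affine maps with $\sigma$ applied coordinatewise between consecutive ones, with at least one hidden layer and hidden layers of arbitrary finite widths (no activation after the last affine map). A *ChannelNet-MLP* with $L\ge 1$ iterations and feature dimension $d$ is given by MLPs $\phi^{(1)}:\mathbb R\to\mathbb R^d$, $\phi^{(t)}:\mathbb R^d\to\mathbb R^d$ ($2\le t\le L$), $\psi^{(t)}:\mathbb R^d\to\mathbb R^d$ ($1\le t<L$) and $\psi^{(L)}:\mathbb R^d\to\mathbb R$. Writing $\Phi^{(t)},\Psi^{(t)}$ for the row-wise application of $\phi^{(t)},\psi^{(t)}$, it computes $$\mathbf U^{(1)}=\mathbf H^{T}\Phi^{(1)}(\mathbf y),\qquad \mathbf U^{(t+1)}=\mathbf U^{(t)}+\mathbf H^{T}\,\Phi^{(t+1)}\big(\mathbf H\,\Psi^{(t)}(\mathbf U^{(t)})-\mathbf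 y\mathbf 1_d^{T}\big)\quad(1\le t<L),$$ and represents the function $f(\mathbf H,\mathbf y)=\Psi^{(L)}(\mathbf U^{(L)})\in\mathbb R^K$. Let $X\subset\mathbb R^{N\times(K+1)}$ be compact and let $P$ be a Borel probability measure on $X$. Assume that $P$ is absolutely continuous with respect to Lebesgue measure on $\mathbb R^{N\times(K+1)}$, or that for $P$-almost every $(\mathbf H,\mathbf y)$ all entries of $\mathbf H$ are nonzero, all column sums $\sum_{j=1}^N\mathbf H_{ji}$ ($1\le i\le K$) are nonzero, and the entries of $\mathbf y$ are pairwise distinct. Let $g:X\to\mathbb R^K$ be continuous and permutation-equivariant, that is, for all permutation matrices $\mathbf P_{rx}$ of size $N$ and $\mathbf P_{tx}$ of size $K$, $$g(\mathbf P_{rx}\mathbf H\mathbf P_{tx},\ \mathbf P_{rx}\mathbf y)=\mathbf P_{tx}^{T}\,g(\mathbf H,\mathbf y)$$ whenever $(\mathbf H,\mathbf y)$ and $(\mathbf P_{rx}\mathbf H\mathbf P_{tx},\mathbf P_{rx}\mathbf y)$ both lie in $X$. Then for all $\epsilon>0$ and $0<\delta<1$ there is a function $f$ represented by a ChannelNet-MLP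 (with activation $\sigma$) such that $$P\big(\{(\mathbf H,\mathbf y)\in X:\ \|g(\mathbf H,\mathbf y)-f(\mathbf H,\mathbf y)\|<\epsilon\}\big)>1-\delta .$$ -/

import Mathlib

open MeasureTheory

/-- A multilayer perceptron from `ℝᵐ` to `ℝⁿ`, given by its weights and biases. It has at least one
hidden layer, hidden layers of arbitrary widths, and an affine output layer. -/
inductive MLP : ℕ → ℕ → Type
  /-- One hidden layer `(A, b)` of width `p`, followed by the affine output layer `(C, c)`. -/
  | shallow {m p n : ℕ} (A : Matrix (Fin p) (Fin m) ℝ) (b : Fin p → ℝ)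
      (C : Matrix (Fin n) (Fin p) ℝ) (c : Fin n → ℝ) : MLP m n
  /-- A further hidden layer `(A, b)` of width `p` in front of a given perceptron. -/
  | deepen {m p n : ℕ} (A : Matrix (Fin p) (Fin m) ℝ) (b : Fin p → ℝ) (net : MLP p n) : MLP m n

/-- The function computed by a multilayer perceptron whose hidden units use the activation `σ`. -/
def MLP.eval (σ : ℝ → ℝ) : {m n : ℕ} → MLP m n → (Fin m → ℝ) → (Fin n → ℝ)
  | _, _, .shallow A b C c => fun x => C.mulVec (fun q => σ ((A.mulVec x + b) q)) + c
  | _, _, .deepen A b net => fun x => net.eval σ (fun q => σ ((A.mulVec x + b) q))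

/-- Pairs `(H, y)` of an `N × K` real channel matrix and a received vector in `ℝᴺ`; rows are indexed
by receive antennas and columns by transmit antennas. -/
abbrev ChannelInput (N K : ℕ) : Type := (Fin N → Fin K → ℝ) × (Fin N → ℝ)

/-- The parameters of a ChannelNet-MLP with feature dimension `d` and `L + 1` iterations. The
processors of the first iteration on the receive side and of the last iteration on the transmit side
have input, respectively output, dimension one. -/
structure ChannelNetMLP where
  /-- feature dimension -/
  d : ℕ
  /-- number of iterations after the first one -/
  L : ℕ
  /-- receive antenna processor of the first iteration, fed with the entries of `y` -/
  phiFirst : MLP 1 d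
  /-- receive antenna processors of the iterations `2, …, L + 1` -/
  phi : Fin L → MLP d d
  /-- transmit antenna processors of the iterations `1, …, L` -/
  psi : Fin L → MLP d d
  /-- transmit antenna processor of the last iteration -/
  psiLast : MLP d 1

namespace ChannelNetMLP

variable {N K d : ℕ}

/-- Channel layer from receive to transmit features: `F_tx = Hᵀ F_rx`. -/
def toTx (H : Fin N → Fin K → ℝ) (F : Fin N → Fin d → ℝ) : Fin K → Fin d → ℝ :=
  fun i c => ∑ j, H j i * F j c

/-- Channel layer from transmit to receive features: `F_rx = H F_tx`. -/
def toRx (H : Fin N → Fin K → ℝ) (F : Fin K → Fin d → ℝ) : Fin N → Fin d → ℝ :=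
  fun j c => ∑ i, H j i * F i c

/-- The input of the transmit antenna processor in iteration `t + 1`, that is, the transmit features
after the channel layer and after the skip connection. From the second iteration on, the receive
processor is fed with `H F_tx - y 1ᵀ`. -/
def txFeature (σ : ℝ → ℝ) (net : ChannelNetMLP) (x : ChannelInput N K) :
    (t : ℕ) → t ≤ net.L → Fin K → Fin net.d → ℝ
  | 0, _ => toTx x.1 (fun j => net.phiFirst.eval σ (fun _ => x.2 j))
  | t + 1, h =>
      let old := txFeature σ net x t (Nat.le_of_succ_le h)
      let rx : Fin N → Fin net.d → ℝ :=
        fun j c => toRx x.1 (fun i => (net.psi ⟨t, h⟩).eval σ (old i)) j c - x.2 j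
      fun i c => toTx x.1 (fun j => (net.phi ⟨t, h⟩).eval σ (rx j)) i c + old i c

/-- The function represented by a ChannelNet-MLP: one real output per transmit antenna. -/
noncomputable def eval (σ : ℝ → ℝ) (net : ChannelNetMLP) (x : ChannelInput N K) :
    EuclideanSpace ℝ (Fin K) :=
  WithLp.toLp 2 (fun i => net.psiLast.eval σ (net.txFeature σ x net.L le_rfl i) 0)

end ChannelNetMLP

/-- Reordering the receive antennas by `ρ` (rows of `H` and entries of `y`) and the transmit antennas
by `τ` (columns of `H`). -/
def permuteAntennas {N K : ℕ} (ρ : Equiv.Perm (Fin N)) (τ : Equiv.Perm (Fin K))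
    (x : ChannelInput N K) : ChannelInput N K :=
  (fun j i => x.1 (ρ j) (τ i), fun j => x.2 (ρ j))

/-- `g` is permutation-equivariant on `X`: invariant under receive antenna permutations and
equivariant under transmit antenna permutations, whenever both points lie in `X`. -/
def PermEquivariantOn {N K : ℕ} (X : Set (ChannelInput N K))
    (g : ChannelInput N K → EuclideanSpace ℝ (Fin K)) : Prop :=
  ∀ (ρ : Equiv.Perm (Fin N)) (τ : Equiv.Perm (Fin K)), ∀ x ∈ X, permuteAntennas ρ τ x ∈ X →
    ∀ i, g (permuteAntennas ρ τ x) i = g x (τ i)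

/-- Generic inputs: all entries and all column sums of `H` are nonzero, and the entries of `y` are
pairwise distinct. -/
def genericInputs (N K : ℕ) : Set (ChannelInput N K) :=
  {x | (∀ j i, x.1 j i ≠ 0) ∧ (∀ i, ∑ j, x.1 j i ≠ 0) ∧ ∀ k l, k ≠ l → x.2 k ≠ x.2 l}

/-!
The proof computes a complete invariant of the orbit of `(H, y)` together with a marked transmit
antenna, using two iterations with continuous processors, and then replaces these processors by
perceptrons.

*Separation.* A signed measure with at most `M` atoms is determined by its moments with exponents
below `M` (`sum_filter_eq_zero_of_moments_eq_zero`). In the first iteration the powers `y ^ m` give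
transmit antenna `i` the sums `∑ j, H j i * y j ^ m`. If the entries of `y` are distinct and those of
`H` nonzero, they determine the set of pairs `(y j, H j i)`, that is, the column `i` up to the order
of the rows. Feeding monomials of these sums through the channel tells receive antenna `j` the
moments of the measure `∑ i, H j i • δ (column i)`, hence the multiset of all columns: equal columns
have equal entries `H j i`, so the mass of an atom is its multiplicity times a nonzero number. The
second iteration returns these moments to the transmit antennas, multiplied by powers of `y` so that
each can be assigned to its row; the skip connection preserves the marked column. Thus equal features
at `(x, i)` and `(x', i')` force `x'` to arise from `x` by permutations that take `i'` to `i`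
(`exists_permuteAntennas_of_moments_eq`), and then an equivariant `g` has equal outputs there.

*Approximation.* On a compact set of such inputs, `g` is therefore a continuous function of finitely
many features (`ContinuousMap.exists_comp_eq_of_fiber_constant`). The output depends jointly
continuously on the processors, in the compact-open topology, and on the input, so closeness to `g`
on a compact set is an open condition on the processors. Perceptrons are dense in that topology
(`MLP.denseRange_toContinuousMap`): mollifying `σ` and differentiating `t ↦ σ (a * t + b)` in `a`
yields all monomials, hence all continuous ridge functions, among them the exponentials
`x ↦ exp (w ⬝ᵥ x)`, to which the Stone–Weierstrass theorem applies.

*Probability.* In both cases almost every input has nonzero channel entries and distinct received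
values, and inner regularity of `P` supplies a compact set of such inputs of measure above `1 - δ`.
-/

open scoped Topology ContDiff Convolution

/-! ### Univariate density of dilated translates -/

theorem ContinuousMap.mem_closure_of_forall_isCompact {X : Type*} [TopologicalSpace X]
    {S : Set C(X, ℝ)} {f : C(X, ℝ)}
    (h : ∀ K : Set X, IsCompact K → ∀ ε > 0, ∃ g ∈ S, ∀ x ∈ K, |g x - f x| < ε) :
    f ∈ closure S := by
  refine (mem_closure_iff_nhds_basis (nhds_basis_uniformity
    ContinuousMap.hasBasis_compactConvergenceUniformity)).2 ?_
  rintro ⟨K, V⟩ ⟨hK, hV⟩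
  obtain ⟨ε, hε, hεV⟩ := Metric.mem_uniformity_dist.1 hV
  obtain ⟨g, hg, hgK⟩ := h K hK ε hε
  exact ⟨g, hg, fun x hx => hεV (by simpa [Real.dist_eq] using hgK x hx)⟩

theorem Submodule.integral_mem_of_continuous {E : Type*} [NormedAddCommGroup E]
    [NormedSpace ℝ E] [CompleteSpace E] {V : Submodule ℝ E} (hV : IsClosed (V : Set E))
    {f : ℝ → E} (hf : Continuous f) (hf_supp : HasCompactSupport f) (hfV : ∀ s, f s ∈ V) :
    ∫ s, f s ∈ V := by
  have : CompleteSpace V := hV.completeSpace_coe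
  let Φ : ℝ → V := fun s => ⟨f s, hfV s⟩
  have hΦ : Integrable Φ := by
    refine Continuous.integrable_of_hasCompactSupport (hf.subtype_mk _) ?_
    exact hf_supp.mono fun s hs h0 => hs (Subtype.ext h0)
  have h : ∫ s, f s = V.subtypeL (∫ s, Φ s) := V.subtypeL.integral_comp_comm hΦ
  rw [h]
  exact (∫ s, Φ s).2

/-- A closed subspace of `C(ℝ, ℝ)` is closed under integration. As `C(ℝ, ℝ)` carries no norm, the
integral is formed in the Banach spaces `C(K, ℝ)` for compact `K`. -/
theorem Submodule.integral_mem_of_isClosed {W : Submodule ℝ C(ℝ, ℝ)}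
    (hW : IsClosed (W : Set C(ℝ, ℝ))) {F : ℝ → C(ℝ, ℝ)} (hF : Continuous F)
    (hF_supp : HasCompactSupport F) (hFW : ∀ s, F s ∈ W) {G : C(ℝ, ℝ)}
    (hG : ∀ t, G t = ∫ s, F s t) : G ∈ W := by
  rw [← SetLike.mem_coe, ← hW.closure_eq]
  refine ContinuousMap.mem_closure_of_forall_isCompact fun K hK ε hε => ?_
  have : CompactSpace K := isCompact_iff_compactSpace.1 hK
  let R : C(ℝ, ℝ) →ₗ[ℝ] C(K, ℝ) :=
    { toFun := fun f => f.restrict K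
      map_add' := fun _ _ => rfl
      map_smul' := fun _ _ => rfl }
  have hR : Continuous R := ContinuousMap.continuous_restrict K
  have hint : Integrable (fun s => R (F s)) :=
    (hR.comp hF).integrable_of_hasCompactSupport (hF_supp.comp_left (map_zero R))
  let V : Submodule ℝ C(K, ℝ) := (W.map R).topologicalClosure
  have hVc : IsClosed (V : Set C(K, ℝ)) := Submodule.isClosed_topologicalClosure _
  have hJ : ∫ s, R (F s) ∈ V :=
    Submodule.integral_mem_of_continuous hVc (hR.comp hF)
      (hF_supp.comp_left (map_zero R)) fun s => subset_closure ⟨F s, hFW s, rfl⟩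
  obtain ⟨_, ⟨g, hg, rfl⟩, hgJ⟩ := Metric.mem_closure_iff.1 hJ ε hε
  refine ⟨g, hg, fun x hx => ?_⟩
  have h1 : (∫ s, R (F s)) ⟨x, hx⟩ = G x := by
    rw [ContinuousMap.integral_apply hint, hG]
    rfl
  have h2 := ContinuousMap.dist_lt_iff hε |>.1 hgJ ⟨x, hx⟩
  rw [h1, dist_comm, Real.dist_eq] at h2
  exact h2

/-- Differentiating `n` times in the dilation parameter: if a closed subspace contains all
`t ↦ f (a * t + b)`, it contains all `t ↦ t ^ n * f⁽ⁿ⁾ (a * t + b)`. -/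
theorem monomial_mul_iteratedDeriv_mem {W : Submodule ℝ C(ℝ, ℝ)}
    (hW : IsClosed (W : Set C(ℝ, ℝ))) {f : ℝ → ℝ} (hf : ContDiff ℝ ∞ f)
    (hfW : ∀ a b : ℝ, ∀ G : C(ℝ, ℝ), (∀ t, G t = f (a * t + b)) → G ∈ W) (n : ℕ) :
    ∀ a b : ℝ, ∀ G : C(ℝ, ℝ), (∀ t, G t = t ^ n * iteratedDeriv n f (a * t + b)) → G ∈ W := by
  induction n with
  | zero => simpa using hfW
  | succ n ih =>
    intro a b G hG
    have hc (k : ℕ) : Continuous (iteratedDeriv k f) :=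
      hf.continuous_iteratedDeriv k (by exact_mod_cast le_top)
    have hd (t : ℝ) : HasDerivAt (iteratedDeriv n f) (iteratedDeriv (n + 1) f t) t := by
      rw [iteratedDeriv_succ]
      exact (hf.differentiable_iteratedDeriv n
        (by exact_mod_cast ENat.natCast_lt_top _) t).hasDerivAt
    -- the difference quotient in the dilation parameter, extended continuously to `h = 0`
    let Q : ℝ → C(ℝ, ℝ) := fun h =>
      ⟨fun t => t ^ (n + 1) *
        ∫ s in (0:ℝ)..1, iteratedDeriv (n + 1) f ((a * t + b) + s * (h * t)), by
        refine (continuous_id.pow _).mul ?_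
        exact intervalIntegral.continuous_parametric_intervalIntegral_of_continuous'
          (by fun_prop) _ _⟩
    have hQ : Continuous Q := by
      refine ContinuousMap.continuous_of_continuous_uncurry _ ?_
      refine (continuous_snd.pow _).mul ?_
      exact intervalIntegral.continuous_parametric_intervalIntegral_of_continuous' (by fun_prop) _ _
    have hQ0 : Q 0 = G := by
      ext t
      simp [Q, hG]
    have hQW : ∀ h ≠ 0, Q h ∈ W := by
      intro h hh
      let D (c : ℝ) : C(ℝ, ℝ) := ⟨fun t => t ^ n * iteratedDeriv n f (c * t + b), by fun_prop⟩
      have : Q h = h⁻¹ • (D (a + h) - D a) := by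
        ext t
        have key := intervalIntegral.integral_unitInterval_deriv_eq_sub (𝕜 := ℝ)
          (f := iteratedDeriv n f)
          (f' := iteratedDeriv (n + 1) f) (z₀ := a * t + b) (z₁ := h * t)
          (by fun_prop) (fun s _ => hd _)
        simp only [smul_eq_mul] at key
        simp only [Q, D, ContinuousMap.coe_mk, ContinuousMap.smul_apply,
          ContinuousMap.sub_apply, smul_eq_mul]
        rw [← mul_sub, show (a + h) * t + b = a * t + b + h * t by ring, ← key, pow_succ]
        generalize (∫ s in (0:ℝ)..1, iteratedDeriv (n + 1) f (a * t + b + s * (h * t))) = J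
        field_simp
      rw [this]
      exact W.smul_mem _ (W.sub_mem (ih _ _ _ fun _ => rfl) (ih _ _ _ fun _ => rfl))
    rw [← hQ0]
    have : Filter.Tendsto Q (𝓝[≠] 0) (𝓝 (Q 0)) :=
      hQ.continuousAt.tendsto.mono_left nhdsWithin_le_nhds
    exact hW.mem_of_tendsto this (eventually_mem_nhdsWithin.mono hQW)

theorem exists_polynomial_of_iteratedDeriv_eq_zero (n : ℕ) :
    ∀ f : ℝ → ℝ, ContDiff ℝ ∞ f → (∀ t, iteratedDeriv n f t = 0) →
      ∃ p : Polynomial ℝ, p.degree < n ∧ ∀ t, f t = p.eval t := by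
  suffices H : ∀ f : ℝ → ℝ, ContDiff ℝ ∞ f → (∀ t, iteratedDeriv n f t = 0) →
      ∃ c : ℕ → ℝ, ∀ t, f t = ∑ k ∈ Finset.range n, c k * t ^ k by
    intro f hf h0
    obtain ⟨c, hc⟩ := H f hf h0
    refine ⟨∑ k : Fin n, Polynomial.C (c k) * Polynomial.X ^ (k : ℕ),
      Polynomial.degree_sum_fin_lt _, fun t => ?_⟩
    simp [Polynomial.eval_finsetSum, hc, Finset.sum_range]
  induction n with
  | zero =>
    intro f _ h0
    exact ⟨0, by simpa using h0⟩
  | succ n ih =>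
    intro f hf h0
    have hf' : ContDiff ℝ ∞ (deriv f) := (contDiff_infty_iff_deriv.1 hf).2
    obtain ⟨c, hc⟩ := ih (deriv f) hf' (by simpa [iteratedDeriv_succ'] using h0)
    let F : ℝ → ℝ := fun t => ∑ k ∈ Finset.range n, c k / (k + 1) * t ^ (k + 1)
    have hF (t : ℝ) : HasDerivAt F (deriv f t) t := by
      rw [hc]
      refine HasDerivAt.fun_sum fun k _ => ?_
      refine ((hasDerivAt_pow (k + 1) t).const_mul (c k / (k + 1))).congr_deriv ?_
      have : (k + 1 : ℝ) ≠ 0 := by positivity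
      push_cast
      rw [← mul_assoc, div_mul_cancel₀ _ this]
    have hdf : Differentiable ℝ f := (contDiff_infty_iff_deriv.1 hf).1
    have hsub (t : ℝ) : f t - F t = f 0 - F 0 :=
      is_const_of_deriv_eq_zero (f := fun t => f t - F t)
        (hdf.sub fun t => (hF t).differentiableAt)
        (fun t => by simpa using ((hdf t).hasDerivAt.fun_sub (hF t)).deriv) t 0
    refine ⟨fun k => if k = 0 then f 0 else c (k - 1) / k, fun t => ?_⟩
    rw [Finset.sum_range_succ']
    have h1 := hsub t
    have h2 : F 0 = 0 := by simp [F]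
    simp only [F] at h1 h2
    rw [h2] at h1
    simp
    linarith

/-- A pointwise limit of polynomials of bounded degree is a polynomial, by interpolation at finitely
many nodes. -/
theorem exists_polynomial_of_tendsto {n : ℕ} {f : ℕ → ℝ → ℝ} {g : ℝ → ℝ}
    (hf : ∀ k, ∃ p : Polynomial ℝ, p.degree < n ∧ ∀ t, f k t = p.eval t)
    (hlim : ∀ t, Filter.Tendsto (fun k => f k t) Filter.atTop (𝓝 (g t))) :
    ∃ p : Polynomial ℝ, ∀ t, g t = p.eval t := by
  let v : ℕ → ℝ := fun i => i
  have hv : Set.InjOn v (Finset.range n) := fun _ _ _ _ h => Nat.cast_injective h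
  refine ⟨Lagrange.interpolate (Finset.range n) v (fun i => g (v i)), fun t => ?_⟩
  refine tendsto_nhds_unique (hlim t) ?_
  have h1 : (fun k => f k t) = fun k => ∑ i ∈ Finset.range n,
      f k (v i) * (Lagrange.basis (Finset.range n) v i).eval t := by
    ext k
    obtain ⟨p, hp, hpf⟩ := hf k
    rw [hpf, Lagrange.eq_interpolate (s := Finset.range n) (f := p) hv (by simpa using hp)]
    simp only [Lagrange.interpolate_apply, Polynomial.eval_finsetSum, Polynomial.eval_mul,
      Polynomial.eval_C]
    exact Finset.sum_congr rfl fun i _ => by rw [hpf]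
  rw [h1]
  simp only [Lagrange.interpolate_apply, Polynomial.eval_finsetSum, Polynomial.eval_mul,
      Polynomial.eval_C]
  exact tendsto_finsetSum _ fun i _ => (hlim _).mul_const _

/-- Mollifications of a continuous function `σ` stay in any closed subspace that contains all
dilated translates of `σ`. -/
theorem comp_affine_convolution_mem {W : Submodule ℝ C(ℝ, ℝ)}
    (hW : IsClosed (W : Set C(ℝ, ℝ))) {σ : ℝ → ℝ} (hσ : Continuous σ)
    (hσW : ∀ a b : ℝ, ∀ G : C(ℝ, ℝ), (∀ t, G t = σ (a * t + b)) → G ∈ W)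
    {η : ℝ → ℝ} (hη : Continuous η) (hη_supp : HasCompactSupport η)
    (a b : ℝ) (G : C(ℝ, ℝ))
    (hG : ∀ t, G t = (η ⋆[ContinuousLinearMap.lsmul ℝ ℝ, volume] σ) (a * t + b)) : G ∈ W := by
  let T (s : ℝ) : C(ℝ, ℝ) := ⟨fun t => σ (a * t + (b - s)), by fun_prop⟩
  have hT : Continuous T :=
    ContinuousMap.continuous_of_continuous_uncurry _ <|
      show Continuous fun p : ℝ × ℝ => σ (a * p.2 + (b - p.1)) by fun_prop
  refine Submodule.integral_mem_of_isClosed hW (F := fun s => η s • T s) (hη.smul hT)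
    (hη_supp.smul_right) (fun s => W.smul_mem _ (hσW a (b - s) _ fun _ => rfl)) fun t => ?_
  rw [hG, convolution_def]
  simp [T, add_sub_assoc]

/-- Mollifying a non-polynomial function produces, for each `n`, a smooth function whose `n`-th
derivative does not vanish identically. -/
theorem exists_bump_convolution_iteratedDeriv_ne_zero {σ : ℝ → ℝ} (hσ : Continuous σ)
    (hσ_poly : ¬ ∃ p : Polynomial ℝ, ∀ t : ℝ, σ t = p.eval t) (n : ℕ) :
    ∃ η : ℝ → ℝ, Continuous η ∧ HasCompactSupport η ∧
      ContDiff ℝ ∞ (η ⋆[ContinuousLinearMap.lsmul ℝ ℝ, volume] σ) ∧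
      ∃ b, iteratedDeriv n (η ⋆[ContinuousLinearMap.lsmul ℝ ℝ, volume] σ) b ≠ 0 := by
  let φ (k : ℕ) : ContDiffBump (0 : ℝ) :=
    ⟨1 / ((k : ℝ) + 1) / 2, 1 / ((k : ℝ) + 1), by positivity, half_lt_self (by positivity)⟩
  have hsmooth (k : ℕ) : ContDiff ℝ ∞
      ((φ k).normed volume ⋆[ContinuousLinearMap.lsmul ℝ ℝ, volume] σ) :=
    (φ k).hasCompactSupport_normed.contDiff_convolution_left _ (φ k).contDiff_normed
      hσ.locallyIntegrable
  by_contra! h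
  refine hσ_poly (exists_polynomial_of_tendsto (n := n)
    (f := fun k => (φ k).normed volume ⋆[ContinuousLinearMap.lsmul ℝ ℝ, volume] σ)
    (fun k => ?_) (ContDiffBump.convolution_tendsto_right_of_continuous
      tendsto_one_div_add_atTop_nhds_zero_nat hσ))
  exact exists_polynomial_of_iteratedDeriv_eq_zero n _ (hsmooth k)
    (h _ (φ k).continuous_normed (φ k).hasCompactSupport_normed (hsmooth k))

/-- Density of the span of the dilated translates of a non-polynomial `σ`. -/
theorem Submodule.eq_top_of_comp_affine_mem {σ : ℝ → ℝ} (hσ : Continuous σ)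
    (hσ_poly : ¬ ∃ p : Polynomial ℝ, ∀ t : ℝ, σ t = p.eval t) {W : Submodule ℝ C(ℝ, ℝ)}
    (hW : IsClosed (W : Set C(ℝ, ℝ)))
    (hσW : ∀ a b : ℝ, ∀ G : C(ℝ, ℝ), (∀ t, G t = σ (a * t + b)) → G ∈ W) : W = ⊤ := by
  have hmono (n : ℕ) : (ContinuousMap.id ℝ) ^ n ∈ W := by
    obtain ⟨η, hη, hη_supp, hsmooth, b, hb⟩ :=
      exists_bump_convolution_iteratedDeriv_ne_zero hσ hσ_poly n
    rw [← W.smul_mem_iff hb]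
    -- the `n`-th derivative of `a ↦ (η * σ) (a t + b)` at `a = 0` is a multiple of `t ^ n`
    refine monomial_mul_iteratedDeriv_mem hW hsmooth
      (comp_affine_convolution_mem hW hσ hσW hη hη_supp) n 0 b _ fun t => ?_
    simp [mul_comm]
  refine eq_top_iff.2 fun f _ => ?_
  rw [← SetLike.mem_coe, ← hW.closure_eq]
  refine ContinuousMap.mem_closure_of_forall_isCompact fun K hK ε hε => ?_
  obtain ⟨g, hg, hgK⟩ :=
    ContinuousMap.exists_mem_subalgebra_near_continuous_of_isCompact_of_separatesPoints
      (A := Algebra.adjoin ℝ {ContinuousMap.id ℝ})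
      (fun x y hxy => ⟨_, ⟨ContinuousMap.id ℝ, Algebra.self_mem_adjoin_singleton _ _, rfl⟩, hxy⟩)
      f hK hε
  refine ⟨g, ?_, hgK⟩
  obtain ⟨p, rfl⟩ := (Algebra.adjoin_singleton_eq_range_aeval ℝ (ContinuousMap.id ℝ)).le hg
  change Polynomial.aeval _ p ∈ W
  rw [Polynomial.aeval_eq_sum_range]
  exact W.sum_mem fun k _ => W.smul_mem _ (hmono k)

/-! ### Universal approximation by perceptrons -/

theorem MLP.continuous_eval {σ : ℝ → ℝ} (hσ : Continuous σ) {m n : ℕ} (net : MLP m n) :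
    Continuous (net.eval σ) := by
  have hlayer {m p : ℕ} (A : Matrix (Fin p) (Fin m) ℝ) (b : Fin p → ℝ) :
      Continuous fun x : Fin m → ℝ => fun q => σ ((A.mulVec x + b) q) :=
    continuous_pi fun q => hσ.comp <| (continuous_apply q).comp <|
      (continuous_const.matrix_mulVec continuous_id).add continuous_const
  induction net with
  | shallow A b C c => exact (continuous_const.matrix_mulVec (hlayer A b)).add continuous_const
  | deepen A b net ih => exact ih.comp (hlayer A b)

/-- A perceptron as a point of the space of continuous maps with the compact-open topology. -/
def MLP.toContinuousMap {σ : ℝ → ℝ} (hσ : Continuous σ) {m n : ℕ} (net : MLP m n) :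
    C(Fin m → ℝ, Fin n → ℝ) := ⟨net.eval σ, net.continuous_eval hσ⟩

/-- The hidden unit `x ↦ σ (w ⬝ x + b)` with weights and bias `p = (w, b)`. -/
def hiddenUnit {σ : ℝ → ℝ} (hσ : Continuous σ) {m : ℕ} (p : (Fin m → ℝ) × ℝ) :
    C(Fin m → ℝ, ℝ) := ⟨fun x => σ (p.1 ⬝ᵥ x + p.2), by fun_prop⟩

/-- Every continuous ridge function is a limit of combinations of hidden units. -/
theorem ridge_mem_closure_span_hiddenUnit {σ : ℝ → ℝ} (hσ : Continuous σ)
    (hσ_poly : ¬ ∃ p : Polynomial ℝ, ∀ t : ℝ, σ t = p.eval t) {m : ℕ} (w : Fin m → ℝ)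
    (f : C(ℝ, ℝ)) (G : C(Fin m → ℝ, ℝ)) (hG : ∀ x, G x = f (w ⬝ᵥ x)) :
    G ∈ (Submodule.span ℝ (Set.range (hiddenUnit hσ (m := m)))).topologicalClosure := by
  let ℓ : C(Fin m → ℝ, ℝ) := ⟨fun x => w ⬝ᵥ x, by fun_prop⟩
  let R : C(ℝ, ℝ) →ₗ[ℝ] C(Fin m → ℝ, ℝ) :=
    { toFun := fun f => f.comp ℓ
      map_add' := fun _ _ => rfl
      map_smul' := fun _ _ => rfl }
  have hR : Continuous R := ContinuousMap.continuous_precomp ℓ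
  have htop := Submodule.eq_top_of_comp_affine_mem hσ hσ_poly
    (W := (Submodule.span ℝ (Set.range (hiddenUnit hσ (m := m)))).topologicalClosure.comap R)
    ((Submodule.isClosed_topologicalClosure _).preimage hR) fun a b g hg => by
      refine Submodule.le_topologicalClosure _ (Submodule.subset_span ⟨(a • w, b), ?_⟩)
      ext x
      simp [hiddenUnit, R, hg, ℓ]
  have : R f = G := by
    ext x
    simp [R, ℓ, hG]
  rw [← this]
  exact (htop.ge Submodule.mem_top : f ∈ _)

/-- The exponentials `x ↦ exp (w ⬝ x)` are closed under products, so their span is a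
point-separating algebra of ridge functions. -/
theorem closure_span_hiddenUnit_eq_top {σ : ℝ → ℝ} (hσ : Continuous σ)
    (hσ_poly : ¬ ∃ p : Polynomial ℝ, ∀ t : ℝ, σ t = p.eval t) (m : ℕ) :
    (Submodule.span ℝ (Set.range (hiddenUnit hσ (m := m)))).topologicalClosure = ⊤ := by
  set W := (Submodule.span ℝ (Set.range (hiddenUnit hσ (m := m)))).topologicalClosure with hWdef
  have hW : IsClosed (W : Set C(Fin m → ℝ, ℝ)) := Submodule.isClosed_topologicalClosure _
  let E : Multiplicative (Fin m → ℝ) →* C(Fin m → ℝ, ℝ) :=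
    { toFun := fun w => ⟨fun x => Real.exp (w.toAdd ⬝ᵥ x), by fun_prop⟩
      map_one' := by ext x; simp
      map_mul' := fun v w => by ext x; simp [add_dotProduct, Real.exp_add] }
  have hEW : Subalgebra.toSubmodule (Algebra.adjoin ℝ (MonoidHom.mrange E : Set C(Fin m → ℝ, ℝ))) ≤
      W := by
    rw [Algebra.adjoin_eq_span, Submonoid.closure_eq, Submodule.span_le]
    rintro _ ⟨w, rfl⟩
    exact ridge_mem_closure_span_hiddenUnit hσ hσ_poly w.toAdd ⟨Real.exp, Real.continuous_exp⟩ _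
      fun x => rfl
  refine eq_top_iff.2 fun f _ => ?_
  rw [← SetLike.mem_coe, ← hW.closure_eq]
  refine ContinuousMap.mem_closure_of_forall_isCompact fun K hK ε hε => ?_
  obtain ⟨g, hg, hgK⟩ :=
    ContinuousMap.exists_mem_subalgebra_near_continuous_of_isCompact_of_separatesPoints
      (A := Algebra.adjoin ℝ (MonoidHom.mrange E : Set C(Fin m → ℝ, ℝ)))
      (fun x y hxy => by
        obtain ⟨i, hi⟩ := Function.ne_iff.1 hxy
        refine ⟨_, ⟨E (Multiplicative.ofAdd (Pi.single i 1)),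
          Algebra.subset_adjoin ⟨_, rfl⟩, rfl⟩, ?_⟩
        simpa [E] using hi)
      f hK hε
  exact ⟨g, hEW hg, hgK⟩

/-- Coordinatewise combinations of hidden units are computed by one perceptron whose hidden layer
collects the units of all coordinates. -/
theorem exists_mlp_of_forall_mem_span {σ : ℝ → ℝ} (hσ : Continuous σ) {m n : ℕ}
    (F : Fin n → C(Fin m → ℝ, ℝ))
    (hF : ∀ c, F c ∈ Submodule.span ℝ (Set.range (hiddenUnit hσ (m := m)))) :
    ∃ net : MLP m n, ∀ x c, net.eval σ x c = F c x := by
  classical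
  simp only [Finsupp.mem_span_range_iff_exists_finsupp] at hF
  choose l hl using hF
  let s : Finset ((Fin m → ℝ) × ℝ) := Finset.univ.biUnion fun c => (l c).support
  let e : Fin s.card ≃ s := s.equivFin.symm
  refine ⟨.shallow (Matrix.of fun q => (e q).1.1) (fun q => (e q).1.2)
    (Matrix.of fun c q => l c (e q)) 0, fun x c => ?_⟩
  have h1 : (l c).sum (fun p a => a • hiddenUnit hσ p) = ∑ p ∈ s, l c p • hiddenUnit hσ p :=
    Finsupp.sum_of_support_subset _
      (Finset.subset_biUnion_of_mem (fun c => (l c).support) (Finset.mem_univ c)) _ (by simp)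
  rw [← hl c, h1, ← Finset.sum_coe_sort, ← e.sum_comp]
  simp [MLP.eval, Matrix.mulVec, dotProduct, hiddenUnit, ContinuousMap.sum_apply]

/-- Universal approximation for a continuous non-polynomial activation. -/
theorem MLP.denseRange_toContinuousMap {σ : ℝ → ℝ} (hσ : Continuous σ)
    (hσ_poly : ¬ ∃ p : Polynomial ℝ, ∀ t : ℝ, σ t = p.eval t) (m n : ℕ) :
    DenseRange (MLP.toContinuousMap hσ : MLP m n → C(Fin m → ℝ, Fin n → ℝ)) := by
  let S : Set C(Fin m → ℝ, ℝ) := Submodule.span ℝ (Set.range (hiddenUnit hσ (m := m)))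
  have hS : Dense S := Submodule.dense_iff_topologicalClosure_eq_top.2
    (closure_span_hiddenUnit_eq_top hσ hσ_poly m)
  let coords : (Fin n → C(Fin m → ℝ, ℝ)) → C(Fin m → ℝ, Fin n → ℝ) := ContinuousMap.pi
  have h_cont : Continuous coords := ContinuousMap.continuous_of_continuous_uncurry _ <|
    show Continuous fun p : (Fin n → C(Fin m → ℝ, ℝ)) × (Fin m → ℝ) => fun c => p.1 c p.2 by
      fun_prop
  have h_surj : Function.Surjective coords := fun f =>
    ⟨fun c => ⟨fun x => f x c, by fun_prop⟩, rfl⟩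
  refine Dense.mono ?_ (h_surj.denseRange.dense_image h_cont (dense_pi Set.univ fun _ _ => hS))
  rintro _ ⟨F, hF, rfl⟩
  obtain ⟨net, hnet⟩ := exists_mlp_of_forall_mem_span hσ F fun c => hF c trivial
  exact ⟨net, by ext x c; exact hnet x c⟩

/-! ### Separation of inputs by moments -/

/-- The moments with all exponents below the number of atoms determine the mass of each atom of a
signed measure `∑ k, w k • δ (p k)`: the indicator of `u` agrees on the atoms with a product of
one-variable Lagrange polynomials. -/
theorem sum_filter_eq_zero_of_moments_eq_zero {ι A : Type*} [Fintype ι] [Fintype A]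
    {M : ℕ} (hM : Fintype.card ι ≤ M) (w : ι → ℝ) (p : ι → A → ℝ)
    (h : ∀ α : A → Fin M, ∑ k, w k * ∏ a, p k a ^ (α a : ℕ) = 0) (u : A → ℝ)
    [DecidablePred fun k => p k = u] : ∑ k with p k = u, w k = 0 := by
  classical
  rcases (Finset.univ.filter fun k => p k = u).eq_empty_or_nonempty with h0 | ⟨k₀, hk₀⟩
  · rw [h0, Finset.sum_empty]
  have hk₀ : p k₀ = u := by simpa using hk₀
  let V (a : A) : Finset ℝ := Finset.univ.image fun k => p k a
  have hmem (k : ι) (a : A) : p k a ∈ V a := Finset.mem_image_of_mem _ (Finset.mem_univ k)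
  have hu (a : A) : u a ∈ V a := hk₀ ▸ hmem k₀ a
  let L (a : A) : Polynomial ℝ := Lagrange.basis (V a) id (u a)
  have hdeg (a : A) : (L a).natDegree < M := by
    have hcard : (V a).card ≤ M := Finset.card_image_le.trans hM
    have hpos : 0 < (V a).card := Finset.card_pos.2 ⟨_, hu a⟩
    have := Lagrange.degree_basis (v := id) (Set.injOn_id _) (hu a)
    rw [Polynomial.natDegree_eq_of_degree_eq_some this]
    omega
  have hind (k : ι) : ∏ a, (L a).eval (p k a) = if p k = u then 1 else 0 := by
    split_ifs with hk
    · exact Finset.prod_eq_one fun a _ => by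
        rw [hk]
        exact Lagrange.eval_basis_self (v := id) (Set.injOn_id _) (hu a)
    · obtain ⟨a, ha⟩ := Function.ne_iff.1 hk
      exact Finset.prod_eq_zero (Finset.mem_univ a)
        (Lagrange.eval_basis_of_ne (v := id) (Ne.symm ha) (hmem k a))
  calc ∑ k with p k = u, w k = ∑ k, w k * ∏ a, (L a).eval (p k a) := by
        simp [hind, Finset.sum_filter]
    _ = ∑ k, w k * ∑ α : A → Fin M, ∏ a, ((L a).coeff (α a) * p k a ^ (α a : ℕ)) := by
        refine Finset.sum_congr rfl fun k _ => ?_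
        congr 1
        simp_rw [fun a => Polynomial.eval_eq_sum_range' (hdeg a) (p k a), Finset.sum_range]
        rw [Finset.prod_univ_sum, Fintype.piFinset_univ]
    _ = ∑ α : A → Fin M, (∏ a, (L a).coeff (α a)) * ∑ k, w k * ∏ a, p k a ^ (α a : ℕ) := by
        simp_rw [Finset.mul_sum, Finset.prod_mul_distrib]
        rw [Finset.sum_comm]
        exact Finset.sum_congr rfl fun _ _ => Finset.sum_congr rfl fun _ _ => by ring
    _ = 0 := by simp [h]

theorem sum_filter_eq_of_moments_eq {ι ι' A : Type*} [Fintype ι] [Fintype ι'] [Fintype A]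
    {M : ℕ} (hM : Fintype.card ι + Fintype.card ι' ≤ M)
    {w : ι → ℝ} {p : ι → A → ℝ} {w' : ι' → ℝ} {p' : ι' → A → ℝ}
    (h : ∀ α : A → Fin M,
      ∑ k, w k * ∏ a, p k a ^ (α a : ℕ) = ∑ k, w' k * ∏ a, p' k a ^ (α a : ℕ)) (u : A → ℝ)
    [DecidablePred fun k => p k = u] [DecidablePred fun k => p' k = u] :
    ∑ k with p k = u, w k = ∑ k with p' k = u, w' k := by
  classical
  have key := sum_filter_eq_zero_of_moments_eq_zero (ι := ι ⊕ ι') (by simpa using hM)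
    (Sum.elim w (-w')) (Sum.elim p p') (fun α => by simp [Fintype.sum_sum_type, h α]) u
  simp only [Finset.sum_filter, Fintype.sum_sum_type, Sum.elim_inl, Sum.elim_inr, Pi.neg_apply]
    at key ⊢
  rw [← sub_eq_zero, sub_eq_add_neg, ← Finset.sum_neg_distrib]
  refine Eq.trans ?_ key
  refine congrArg₂ _ (Finset.sum_congr rfl fun k _ => ?_) (Finset.sum_congr rfl fun k _ => ?_)
  · by_cases hk : p k = u <;> simp [hk]
  · by_cases hk : p' k = u <;> simp [hk]

theorem sum_filter_eq_of_power_sums_eq {N : ℕ} {w w' y y' : Fin N → ℝ}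
    (h : ∀ m : Fin (N + N), ∑ j, w j * y j ^ (m : ℕ) = ∑ j, w' j * y' j ^ (m : ℕ)) (u : ℝ) :
    ∑ j with y j = u, w j = ∑ j with y' j = u, w' j := by
  have := sum_filter_eq_of_moments_eq (A := Unit) (M := N + N) (by simp)
    (w := w) (p := fun j _ => y j) (w' := w') (p' := fun j _ => y' j)
    (fun α => by simpa using h (α ())) (fun _ => u)
  simpa [funext_iff] using this

/-- Power sums of nodes along a permutation recover the weights. -/
theorem weights_eq_of_power_sums_eq {N : ℕ} {w w' y y' : Fin N → ℝ} {ρ : Equiv.Perm (Fin N)}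
    (hy : Function.Injective y) (hρ : ∀ j, y' j = y (ρ j))
    (h : ∀ m : Fin (N + N), ∑ j, w j * y j ^ (m : ℕ) = ∑ j, w' j * y' j ^ (m : ℕ)) (j : Fin N) :
    w' j = w (ρ j) := by
  have := sum_filter_eq_of_power_sums_eq h (y' j)
  simpa [hρ, hy.eq_iff, Finset.filter_eq'] using this.symm

/-- Each node `y' j` carries nonzero mass on one side, hence occurs among the nodes `y`. -/
theorem exists_perm_of_power_sums_eq {N : ℕ} {w w' y y' : Fin N → ℝ}
    (hy' : Function.Injective y') (hw' : ∀ j, w' j ≠ 0)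
    (h : ∀ m : Fin (N + N), ∑ j, w j * y j ^ (m : ℕ) = ∑ j, w' j * y' j ^ (m : ℕ)) :
    ∃ ρ : Equiv.Perm (Fin N), ∀ j, y' j = y (ρ j) := by
  have hex (j : Fin N) : ∃ k, y' j = y k := by
    by_contra! hne
    have := sum_filter_eq_of_power_sums_eq h (y' j)
    rw [Finset.filter_false_of_mem fun k _ => (hne k).symm] at this
    refine hw' j ?_
    simpa [hy'.eq_iff, Finset.filter_eq'] using this.symm
  choose ρ hρ using hex
  have hinj : Function.Injective ρ := fun j k hjk => hy' (by rw [hρ, hρ, hjk])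
  exact ⟨Equiv.ofBijective ρ (Finite.injective_iff_bijective.1 hinj), hρ⟩

/-- The power sums `∑ j, H j i * y j ^ m` of column `i`; they encode the set of pairs
`(y j, H j i)`. -/
def columnMoments {N K : ℕ} (x : ChannelInput N K) (i : Fin K) (m : Fin (N + N)) : ℝ :=
  ∑ j, x.1 j i * x.2 j ^ (m : ℕ)

/-- The moments, as seen by receive antenna `j`, of the column encodings `columnMoments x i`
weighted by the entries `H j i`. -/
def rowMoments {N K : ℕ} (x : ChannelInput N K) (j : Fin N)
    (α : Fin (N + N) → Fin (K + K)) : ℝ :=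
  ∑ i, x.1 j i * ∏ m, columnMoments x i m ^ (α m : ℕ)

/-- Column `i` together with all row moments, collected through power sums in `y`. -/
def mixedMoments {N K : ℕ} (x : ChannelInput N K) (i : Fin K) (m : Fin (N + N))
    (α : Fin (N + N) → Fin (K + K)) : ℝ :=
  ∑ j, x.1 j i * (rowMoments x j α * x.2 j ^ (m : ℕ))

/-- Inputs with nonzero channel entries and pairwise distinct received values. Column sums play no
role in the separation of inputs, so this is larger than `genericInputs`. -/
def separableInputs (N K : ℕ) : Set (ChannelInput N K) :=
  {x | (∀ j i, x.1 j i ≠ 0) ∧ Function.Injective x.2}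

theorem card_filter_eq_of_sum_eq {ι : Type*} [Fintype ι] {p q : ι → Prop} [DecidablePred p]
    [DecidablePred q] {v w : ι → ℝ} {c : ℝ} (hc : c ≠ 0) (hv : ∀ k, p k → v k = c)
    (hw : ∀ k, q k → w k = c) (h : ∑ k with p k, v k = ∑ k with q k, w k) :
    (Finset.univ.filter p).card = (Finset.univ.filter q).card := by
  rw [Finset.sum_congr rfl fun k hk => hv k (Finset.mem_filter.1 hk).2,
    Finset.sum_congr rfl fun k hk => hw k (Finset.mem_filter.1 hk).2] at h
  simpa [hc] using h

/-- Maps with equally large fibres agree up to a permutation, which may be composed with a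
transposition inside a fibre to match the marked points `i` and `i'`. -/
theorem exists_perm_of_card_fiber_eq {ι γ : Type*} [Fintype ι] [DecidableEq ι] [DecidableEq γ]
    {f g : ι → γ}
    (h : ∀ c, (Finset.univ.filter fun k => f k = c).card =
      (Finset.univ.filter fun k => g k = c).card) {i i' : ι} (hi : f i = g i') :
    ∃ τ : Equiv.Perm ι, (∀ k, f (τ k) = g k) ∧ τ i' = i := by
  have e (c : γ) : {k // g k = c} ≃ {k // f k = c} := Fintype.equivOfCardEq <| by
    rw [Fintype.card_subtype, Fintype.card_subtype, h]
  let τ : Equiv.Perm ι := Equiv.ofFiberEquiv e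
  have hτ (k : ι) : f (τ k) = g k := Equiv.ofFiberEquiv_map e k
  refine ⟨τ.trans (Equiv.swap (τ i') i), fun k => ?_, by simp⟩
  rw [Equiv.trans_apply, ← hτ k, Equiv.swap_apply_def]
  split_ifs with h1 h2
  · rw [hi, ← hτ, h1]
  · rw [hτ, ← hi, h2]
  · rfl

/-- Equal moments force two inputs to differ by antenna permutations. -/
theorem exists_permuteAntennas_of_moments_eq {N K : ℕ} {x x' : ChannelInput N K}
    (hx : x ∈ separableInputs N K) (hx' : x' ∈ separableInputs N K) {i i' : Fin K}
    (hcol : ∀ m, columnMoments x i m = columnMoments x' i' m)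
    (hmix : ∀ m α, mixedMoments x i m α = mixedMoments x' i' m α) :
    ∃ (ρ : Equiv.Perm (Fin N)) (τ : Equiv.Perm (Fin K)), x' = permuteAntennas ρ τ x ∧ τ i' = i := by
  -- without receive antennas there is only one input, and any two columns may be exchanged
  rcases Nat.eq_zero_or_pos N with rfl | hN
  · exact ⟨1, Equiv.swap i i', Subsingleton.elim _ _, Equiv.swap_apply_right _ _⟩
  let j₀ : Fin N := ⟨0, hN⟩
  obtain ⟨ρ, hρ⟩ := exists_perm_of_power_sums_eq hx'.2 (fun j => hx'.1 j i') hcol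
  have hH (k l : Fin K) (h : columnMoments x k = columnMoments x' l) (j : Fin N) :
      x'.1 j l = x.1 (ρ j) k :=
    weights_eq_of_power_sums_eq (w := fun j => x.1 j k) (w' := fun j => x'.1 j l) hx.2 hρ
      (fun m => congrFun h m) j
  have hHx (k l : Fin K) (h : columnMoments x k = columnMoments x l) (j : Fin N) :
      x.1 j l = x.1 j k :=
    weights_eq_of_power_sums_eq (w := fun j => x.1 j k) (w' := fun j => x.1 j l) (ρ := 1) hx.2
      (fun _ => rfl) (fun m => congrFun h m) j
  have hHx' (k l : Fin K) (h : columnMoments x' k = columnMoments x' l) (j : Fin N) :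
      x'.1 j l = x'.1 j k :=
    weights_eq_of_power_sums_eq (w := fun j => x'.1 j k) (w' := fun j => x'.1 j l) (ρ := 1) hx'.2
      (fun _ => rfl) (fun m => congrFun h m) j
  -- the factor `H j i` of the mixed moments is nonzero and cancels row by row
  have hrow (j : Fin N) (α) : rowMoments x' j α = rowMoments x (ρ j) α := by
    have h := weights_eq_of_power_sums_eq (w := fun j => x.1 j i * rowMoments x j α)
      (w' := fun j => x'.1 j i' * rowMoments x' j α) hx.2 hρ
      (fun m => by simpa only [mixedMoments, mul_assoc] using hmix m α) j
    simp only [hH i i' (funext hcol)] at h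
    exact mul_left_cancel₀ (hx.1 _ _) h
  -- columns with the same encoding have the same entry in row `j₀`, so the mass of each atom is
  -- its multiplicity times that nonzero entry
  have hcard (u : Fin (N + N) → ℝ) :
      (Finset.univ.filter fun k => columnMoments x k = u).card =
        (Finset.univ.filter fun k => columnMoments x' k = u).card := by
    have hsum : ∑ k with columnMoments x k = u, x.1 (ρ j₀) k =
        ∑ k with columnMoments x' k = u, x'.1 j₀ k :=
      sum_filter_eq_of_moments_eq (M := K + K) (by simp) (fun α => (hrow j₀ α).symm) u
    by_cases h1 : ∃ k, columnMoments x k = u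
    · obtain ⟨k, hk⟩ := h1
      exact card_filter_eq_of_sum_eq (hx.1 (ρ j₀) k) (fun l hl => hHx k l (hk.trans hl.symm) _)
        (fun l hl => hH k l (hk.trans hl.symm) _) hsum
    by_cases h2 : ∃ k, columnMoments x' k = u
    · obtain ⟨k, hk⟩ := h2
      exact card_filter_eq_of_sum_eq (hx'.1 j₀ k) (fun l hl => (h1 ⟨l, hl⟩).elim)
        (fun l hl => hHx' k l (hk.trans hl.symm) _) hsum
    · exact card_filter_eq_of_sum_eq one_ne_zero (fun l hl => (h1 ⟨l, hl⟩).elim)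
        (fun l hl => (h2 ⟨l, hl⟩).elim) hsum
  obtain ⟨τ, hτ, hτi⟩ := exists_perm_of_card_fiber_eq hcard (funext hcol)
  exact ⟨ρ, τ, Prod.ext (funext fun j => funext fun k => hH _ _ (hτ k) j) (funext hρ), hτi⟩

/-! ### Two iterations with continuous processors -/

namespace ChannelNetMLP

/-- The processors `(φ₁, ψ, φ₂)` of two iterations before the output map, with arbitrary continuous
maps in place of perceptrons: `φ₁` and `φ₂` act at the receive antennas, `ψ` in between at the
transmit antennas. The spaces carry the compact-open topology. -/
abbrev Processors (d : ℕ) : Type :=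
  C(Fin 1 → ℝ, Fin d → ℝ) × C(Fin d → ℝ, Fin d → ℝ) × C(Fin d → ℝ, Fin d → ℝ)

/-- The transmit features after two iterations with the continuous processors `p`. -/
def twoRoundFeature {N K d : ℕ} (p : Processors d) (x : ChannelInput N K) (i : Fin K)
    (c : Fin d) : ℝ :=
  toTx x.1 (fun j => p.2.2 fun c =>
      toRx x.1 (fun i => p.2.1 (toTx x.1 (fun j => p.1 fun _ => x.2 j) i)) j c - x.2 j) i c +
    toTx x.1 (fun j => p.1 fun _ => x.2 j) i c

/-- Evaluation is jointly continuous on `C(X, Y) × X` for locally compact `X`; hence so are the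
features in the processors and the input. -/
theorem continuous_twoRoundFeature {N K d : ℕ} :
    Continuous fun z : Processors d × ChannelInput N K => twoRoundFeature z.1 z.2 := by
  unfold twoRoundFeature toTx toRx
  fun_prop

/-- The channels used to collect moments: the column moments, the products of column moments with
one idle channel `none` that carries `-y`, and the mixed moments. -/
abbrev MomentChannel (N K : ℕ) : Type :=
  Fin (N + N) ⊕ Option (Fin (N + N) → Fin (K + K)) ⊕ (Fin (N + N) × (Fin (N + N) → Fin (K + K)))

/-- Some continuous processors have the column and mixed moments among their features. The skip
connection is what keeps the column moments through the second iteration. -/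
theorem exists_twoRoundFeature_eq_moments (N K : ℕ) :
    ∃ (d : ℕ) (p : Processors d),
      (∀ m, ∃ c, ∀ (x : ChannelInput N K) i, twoRoundFeature p x i c = columnMoments x i m) ∧
      ∀ m α, ∃ c, ∀ (x : ChannelInput N K) i, twoRoundFeature p x i c = mixedMoments x i m α := by
  let e := Fintype.equivFin (MomentChannel N K)
  let d := Fintype.card (MomentChannel N K)
  let φ₁ : C(Fin 1 → ℝ, Fin d → ℝ) :=
    ⟨fun v c => Sum.elim (fun m : Fin (N + N) => v 0 ^ (m : ℕ)) (fun _ => 0) (e.symm c), by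
      refine continuous_pi fun c => ?_
      rcases e.symm c with m | _ <;> simp only [Sum.elim_inl, Sum.elim_inr] <;> fun_prop⟩
  let ψ : C(Fin d → ℝ, Fin d → ℝ) :=
    ⟨fun u c => Sum.elim (fun _ => 0) (Sum.elim (fun o => o.elim 0 fun α =>
      ∏ m, u (e (Sum.inl m)) ^ (α m : ℕ)) (fun _ => 0)) (e.symm c), by
      refine continuous_pi fun c => ?_
      rcases e.symm c with _ | _ | _ <;> simp only [Sum.elim_inl, Sum.elim_inr]
      · fun_prop
      · rename_i o
        cases o <;> simp only [Option.elim] <;> fun_prop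
      · fun_prop⟩
  -- the second receive processor is fed with residuals; subtracting the idle channel restores the
  -- row moments, and negating it restores `y`
  let φ₂ : C(Fin d → ℝ, Fin d → ℝ) :=
    ⟨fun r c => Sum.elim (fun _ => 0) (Sum.elim (fun _ => 0) (fun q =>
      (r (e (Sum.inr (Sum.inl (some q.2)))) - r (e (Sum.inr (Sum.inl none)))) *
        (-r (e (Sum.inr (Sum.inl none)))) ^ (q.1 : ℕ))) (e.symm c), by
      refine continuous_pi fun c => ?_
      rcases e.symm c with _ | _ | _ <;> simp only [Sum.elim_inl, Sum.elim_inr] <;> fun_prop⟩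
  refine ⟨d, (φ₁, ψ, φ₂), fun m => ⟨e (Sum.inl m), fun x i => ?_⟩,
    fun m α => ⟨e (Sum.inr (Sum.inr (m, α))), fun x i => ?_⟩⟩
  · simp [twoRoundFeature, toTx, φ₁, φ₂, columnMoments]
  · simp [twoRoundFeature, toTx, toRx, φ₁, φ₂, ψ, mixedMoments, rowMoments, columnMoments]

end ChannelNetMLP

/-! ### Generic inputs -/

theorem isOpen_separableInputs (N K : ℕ) : IsOpen (separableInputs N K) := by
  have : separableInputs N K = (⋂ j, ⋂ i, {x | x.1 j i ≠ 0}) ∩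
      ⋂ k, ⋂ l, ⋂ _ : k ≠ l, {x | x.2 k ≠ x.2 l} := by
    ext x
    simp [separableInputs, Function.Injective, not_imp_not]
  rw [this]
  refine (isOpen_iInter_of_finite fun j => isOpen_iInter_of_finite fun i =>
    isOpen_ne_fun (by fun_prop) (by fun_prop)).inter (isOpen_iInter_of_finite fun k =>
      isOpen_iInter_of_finite fun l => isOpen_iInter_of_finite fun _ =>
        isOpen_ne_fun (by fun_prop) (by fun_prop))

theorem ae_ne_zero_of_linearMap_ne_zero {N K : ℕ} {ℓ : ChannelInput N K →ₗ[ℝ] ℝ} (hℓ : ℓ ≠ 0) :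
    ∀ᵐ x : ChannelInput N K, ℓ x ≠ 0 := by
  have : (volume : Measure (Fin N → Fin K → ℝ)).IsAddHaarMeasure := by
    apply Measure.pi.isAddHaarMeasure
  have : (volume : Measure (ChannelInput N K)).IsAddHaarMeasure :=
    Measure.prod.instIsAddHaarMeasure volume volume
  have : volume (LinearMap.ker ℓ : Set (ChannelInput N K)) = 0 :=
    Measure.addHaar_submodule _ _ fun h => hℓ (LinearMap.ker_eq_top.1 h)
  rw [ae_iff]
  convert this using 2
  ext x
  simp

theorem ae_mem_separableInputs (N K : ℕ) : ∀ᵐ x : ChannelInput N K, x ∈ separableInputs N K := by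
  have h1 : ∀ᵐ x : ChannelInput N K, ∀ j i, x.1 j i ≠ 0 := by
    refine ae_all_iff.2 fun j => ae_all_iff.2 fun i => ae_ne_zero_of_linearMap_ne_zero
      (ℓ := LinearMap.proj i ∘ₗ LinearMap.proj j ∘ₗ
        LinearMap.fst ℝ (Fin N → Fin K → ℝ) (Fin N → ℝ)) fun h => ?_
    simpa using LinearMap.congr_fun h (fun _ _ => 1, 0)
  have h2 : ∀ᵐ x : ChannelInput N K, ∀ k l, k ≠ l → x.2 k - x.2 l ≠ 0 := by
    refine ae_all_iff.2 fun k => ae_all_iff.2 fun l => ae_all_iff.2 fun hkl => ?_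
    let ℓ : ChannelInput N K →ₗ[ℝ] ℝ :=
      (LinearMap.proj (R := ℝ) (φ := fun _ : Fin N => ℝ) k - LinearMap.proj l) ∘ₗ
        LinearMap.snd ℝ (Fin N → Fin K → ℝ) (Fin N → ℝ)
    have hℓ : ℓ ≠ 0 := fun h => by
      simpa [ℓ, hkl] using LinearMap.congr_fun h (0, Pi.single k 1)
    simpa [ℓ] using ae_ne_zero_of_linearMap_ne_zero hℓ
  filter_upwards [h1, h2] with x hx1 hx2
  refine ⟨hx1, fun k l hkl => ?_⟩
  by_contra hne
  exact hx2 k l hne (sub_eq_zero.2 hkl)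

theorem genericInputs_subset_separableInputs (N K : ℕ) :
    genericInputs N K ⊆ separableInputs N K := fun _ hx =>
  ⟨hx.1, fun k l hkl => by_contra fun hne => hx.2.2 k l hne hkl⟩

/-! ### Approximation on compact sets and in probability -/

/-- A continuous function on a compact space that is constant on the fibres of a continuous map
`E` is a continuous function of `E`. -/
theorem ContinuousMap.exists_comp_eq_of_fiber_constant {Z Y : Type*} [TopologicalSpace Z]
    [CompactSpace Z] [TopologicalSpace Y] [T2Space Y] [NormalSpace Y] (E : C(Z, Y)) (G : C(Z, ℝ))
    (h : ∀ z z', E z = E z' → G z = G z') : ∃ q : C(Y, ℝ), ∀ z, q (E z) = G z := by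
  let E' : C(Z, Set.range E) := ⟨Set.rangeFactorization E, by fun_prop⟩
  have hE' : Topology.IsQuotientMap E' :=
    Topology.IsQuotientMap.of_surjective_continuous Set.rangeFactorization_surjective E'.continuous
  let q₀ : C(Set.range E, ℝ) := hE'.lift G fun z z' hz => h z z' (congrArg Subtype.val hz)
  obtain ⟨q, hq⟩ := q₀.exists_restrict_eq (isCompact_range E.continuous).isClosed
  refine ⟨q, fun z => ?_⟩
  have h1 : q (E z) = q₀ (E' z) := congr($hq (E' z))
  rw [h1]
  exact congr($(hE'.lift_comp G fun z z' hz => h z z' (congrArg Subtype.val hz)) z)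

/-- Uniform approximation on a compact set of separable inputs: equivariance makes `g` a function
of the moment features, hence exactly computable with continuous processors, and these are replaced
by perceptrons using density. -/
theorem exists_channelNetMLP_forall_norm_sub_lt {σ : ℝ → ℝ} (hσ : Continuous σ)
    (hσ_poly : ¬ ∃ p : Polynomial ℝ, ∀ t : ℝ, σ t = p.eval t) {N K : ℕ}
    {C : Set (ChannelInput N K)} (hC : IsCompact C) (hCs : C ⊆ separableInputs N K)
    {g : ChannelInput N K → EuclideanSpace ℝ (Fin K)} (hg : ContinuousOn g C)
    (hg_equiv : PermEquivariantOn C g) {ε : ℝ} (hε : 0 < ε) :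
    ∃ net : ChannelNetMLP, ∀ x ∈ C, ‖g x - net.eval σ x‖ < ε := by
  obtain ⟨d, p₁, hcol, hmix⟩ := ChannelNetMLP.exists_twoRoundFeature_eq_moments N K
  have : CompactSpace C := isCompact_iff_compactSpace.1 hC
  have hgC : Continuous fun x : C => g x := continuousOn_iff_continuous_domRestrict.1 hg
  let E : C(C × Fin K, Fin d → ℝ) :=
    ⟨fun z : C × Fin K => ChannelNetMLP.twoRoundFeature p₁ (z.1 : ChannelInput N K) z.2, by
      refine continuous_prod_of_discrete_right.2 fun i => ?_
      exact (continuous_apply i).comp (ChannelNetMLP.continuous_twoRoundFeature.comp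
        (f := fun x : C => (p₁, (x : ChannelInput N K))) (by fun_prop))⟩
  let G : C(C × Fin K, ℝ) := ⟨fun z => g z.1 z.2, by
    refine continuous_prod_of_discrete_right.2 fun i => ?_
    exact (continuous_apply i).comp ((PiLp.continuous_ofLp 2 _).comp hgC)⟩
  obtain ⟨q, hq⟩ := E.exists_comp_eq_of_fiber_constant G fun z z' hz => by
    obtain ⟨⟨x, hx⟩, i⟩ := z
    obtain ⟨⟨x', hx'⟩, i'⟩ := z'
    have hz (c : Fin d) : ChannelNetMLP.twoRoundFeature p₁ x i c =
        ChannelNetMLP.twoRoundFeature p₁ x' i' c := congrFun hz c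
    obtain ⟨ρ, τ, rfl, rfl⟩ := exists_permuteAntennas_of_moments_eq (hCs hx) (hCs hx')
      (i := i) (i' := i')
      (fun m => by obtain ⟨c, hc⟩ := hcol m; rw [← hc, ← hc, hz])
      (fun m α => by obtain ⟨c, hc⟩ := hmix m α; rw [← hc, ← hc, hz])
    exact (hg_equiv ρ τ x hx hx' i').symm
  let out (p : ChannelNetMLP.Processors d × C(Fin d → ℝ, Fin 1 → ℝ)) (x : ChannelInput N K) :
      EuclideanSpace ℝ (Fin K) :=
    WithLp.toLp 2 fun i => p.2 (ChannelNetMLP.twoRoundFeature p.1 x i) 0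
  have hout : Continuous fun z : (ChannelNetMLP.Processors d × C(Fin d → ℝ, Fin 1 → ℝ)) × C =>
      ‖g z.2 - out z.1 z.2‖ := by
    refine ((hgC.comp continuous_snd).sub ((PiLp.continuous_toLp 2 _).comp ?_)).norm
    refine continuous_pi fun i => (continuous_apply 0).comp ?_
    exact (continuous_snd.comp continuous_fst).eval <| (continuous_apply i).comp <|
      ChannelNetMLP.continuous_twoRoundFeature.comp
        (f := fun z : (ChannelNetMLP.Processors d × C(Fin d → ℝ, Fin 1 → ℝ)) × C =>
          (z.1.1, (z.2 : ChannelInput N K))) (by fun_prop)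
  let p₀ : ChannelNetMLP.Processors d × C(Fin d → ℝ, Fin 1 → ℝ) :=
    (p₁, ⟨fun u _ => q u, by fun_prop⟩)
  have hp₀ (x : C) : g x - out p₀ x = 0 := by
    rw [sub_eq_zero]
    ext i
    exact (hq (x, i)).symm
  -- being `ε`-close to `g` on all of `C` is an open condition on the processors, by compactness
  have hev : ∀ᶠ p in 𝓝 p₀, ∀ x ∈ (Set.univ : Set C), ‖g x - out p x‖ < ε :=
    isCompact_univ.eventually_forall_of_forall_eventually fun x _ =>
      hout.continuousAt.eventually_lt continuousAt_const (by simpa [hp₀] using hε)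
  have hdense := (((MLP.denseRange_toContinuousMap hσ hσ_poly 1 d).prodMap
    ((MLP.denseRange_toContinuousMap hσ hσ_poly d d).prodMap
      (MLP.denseRange_toContinuousMap hσ hσ_poly d d))).prodMap
    (MLP.denseRange_toContinuousMap hσ hσ_poly d 1))
  obtain ⟨_, hp, ⟨⟨n₁, n₂, n₃⟩, n₄⟩, rfl⟩ := mem_closure_iff_nhds.1 (hdense p₀) _ hev
  -- one iteration after the first one, so the field `L` is `1`
  exact ⟨⟨d, 1, n₁, fun _ => n₃, fun _ => n₂, n₄⟩, fun x hx => hp ⟨x, hx⟩ trivial⟩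

theorem theorem1 (σ : ℝ → ℝ) (hσ : Continuous σ)
    (hσ_poly : ¬ ∃ p : Polynomial ℝ, ∀ t : ℝ, σ t = p.eval t)
    (N K : ℕ) (X : Set (ChannelInput N K)) (hX : IsCompact X)
    (P : Measure (ChannelInput N K)) [IsProbabilityMeasure P] (hPX : P Xᶜ = 0)
    (hP : P ≪ (volume : Measure (ChannelInput N K)) ∨ ∀ᵐ x ∂P, x ∈ genericInputs N K)
    (g : ChannelInput N K → EuclideanSpace ℝ (Fin K)) (hg : ContinuousOn g X)
    (hg_equiv : PermEquivariantOn X g)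
    (ε δ : ℝ) (hε : 0 < ε) (hδ : 0 < δ) (hδ_one : δ < 1) :
    ∃ net : ChannelNetMLP, 1 - δ < P.real {x | x ∈ X ∧ ‖g x - net.eval σ x‖ < ε} := by
  have hsep : ∀ᵐ x ∂P, x ∈ separableInputs N K := hP.elim
    (fun h => h.ae_le (ae_mem_separableInputs N K))
    (fun h => h.mono fun x hx => genericInputs_subset_separableInputs N K hx)
  have hS : P (X ∩ separableInputs N K) = 1 :=
    (mem_ae_iff_prob_eq_one (hX.isClosed.measurableSet.inter
      (isOpen_separableInputs N K).measurableSet)).1 (Filter.inter_mem (mem_ae_iff.2 hPX) hsep)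
  obtain ⟨C, hCS, hC, hPC⟩ : ∃ C ⊆ X ∩ separableInputs N K, IsCompact C ∧
      ENNReal.ofReal (1 - δ) < P C :=
    (hX.isClosed.measurableSet.inter (isOpen_separableInputs N K).measurableSet).exists_lt_isCompact
      (by rw [hS, ENNReal.ofReal_lt_one]; linarith)
  obtain ⟨net, hnet⟩ := exists_channelNetMLP_forall_norm_sub_lt hσ hσ_poly hC
    (hCS.trans Set.inter_subset_right) (hg.mono (hCS.trans Set.inter_subset_left))
    (fun ρ τ x hx hx' => hg_equiv ρ τ x (hCS hx).1 (hCS hx').1) hε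
  refine ⟨net, lt_of_lt_of_le ((ENNReal.ofReal_lt_iff_lt_toReal (by linarith)
    (measure_ne_top _ _)).1 hPC) (measureReal_mono fun x hx => ⟨(hCS hx).1, hnet x hx⟩)⟩
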